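/- Let $k$ be a field and let $\mathcal A$ be a finitely generated commutative cancellative semigroup with zero element which is combinatorially finite (every $\mathbf a\in\mathcal A\setminus\{0\}$ can be written in only finitely many ways as a sum of elements of $\mathcal A\setminus\{0\}$) and whose associated commutative group $G(\mathcal A)$ is torsion free. Fix generators $\mathbf a_1,\dots,\mathbf a_r$ of $\mathcal A$, let $R=k[X_1,\dots,X_r]$ be $\mathcal A$-graded by giving $X_i$ degree $\mathbf a_i$, and let $I_{\mathcal A}$ be the kernel of the $k$-algebra morphism $R\to k[\mathcal A]$, $X_i\mapsto \mathbf t^{\mathbf a_i}$. Fix positive integers $d_1,\dots,d_r$ such that $\sum_i d_iu_i=\sum_i d_iv_i$ whenever $\sum_i u_i\mathbf a_i=\sum_i v_i\mathbf a_i$ $(\mathbf u,\mathbf v\in\mathbb N^r)$. For each $i\in\{1,\dots,r\}$ let $\prec_i$ be a degree reverse lexicographical term order on $R$ which has $X_i$ as lowest variable, that is, a term order represented by a real $r\times r$ matrix whose first row is $(d_1,\dots,d_r)$ and whose second row (if $r\ge 2$) is $-\mathbf e_i'$, where $\mathbf e_i$ is the $i$-th canonical basis vector. An element $\mathbf a\in\mathcal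 A$ is called an indispensable $\mathcal A$-degree of $I_{\mathcal A}$ if every minimal system of $\mathcal A$-homogeneous generators of $I_{\mathcal A}$ contains one and only one polynomial of $\mathcal A$-degree $\mathbf a$; in this case this polynomial, which is (up to a nonzero scalar) a difference $X^{\mathbf u}-X^{\mathbf v}$ of two monomials, is called an indispensable binomial of $I_{\mathcal A}$. If a system of generators $\mathcal G$ of $I_{\mathcal A}$ is, up to multiplying its elements by nonzero scalars (for differences of monomials: up to sign), the reduced Gröbner basis of $I_{\mathcal A}$ with respect to $\prec_i$ for every $i\in\{1,\dots,r\}$, then $I_{\mathcal A}$ is generated by its indispensable binomials. -/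

import Mathlib

noncomputable section

namespace SemigroupIdeal

open MvPolynomial

/-- An additive commutative monoid is combinatorially finite if every nonzero element can be written
in only finitely many ways as a sum of nonzero elements (a way of writing is a finite multiset of
summands). -/
def IsCombinatoriallyFinite (A : Type*) [AddCommMonoid A] : Prop :=
  ∀ x : A, x ≠ 0 → {s : Multiset A | (0 : A) ∉ s ∧ s.sum = x}.Finite

/-- The semigroup ideal `I_A`: the kernel of the `k`-algebra morphism
`k[X_1, …, X_r] → k[A]`, `X_i ↦ t ^ (a_i)`. -/
def semigroupIdeal (k : Type*) [Field k] {A : Type*} [AddCommMonoid A] {r : ℕ} (a : Fin r → A) :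
    Ideal (MvPolynomial (Fin r) k) :=
  RingHom.ker (aeval (fun i => AddMonoidAlgebra.single (a i) (1 : k)) :
    MvPolynomial (Fin r) k →ₐ[k] AddMonoidAlgebra k A)

/-- A (pure difference) binomial: a difference of two distinct monomials. -/
def IsBinomial {k : Type*} [Field k] {r : ℕ} (f : MvPolynomial (Fin r) k) : Prop :=
  ∃ u v : Fin r →₀ ℕ, u ≠ v ∧ f = monomial u 1 - monomial v 1

/-- `S` is a system of `A`-homogeneous generators of `I_A`, the variable `X_i` having degree
`a i`. -/
def IsHomogeneousGenSystem {k : Type*} [Field k] {A : Type*} [AddCommMonoid A] {r : ℕ}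
    (a : Fin r → A) (S : Set (MvPolynomial (Fin r) k)) : Prop :=
  (∀ f ∈ S, ∃ α : A, IsWeightedHomogeneous a f α) ∧ Ideal.span S = semigroupIdeal k a

/-- `α` is an indispensable degree of `I_A`: every (inclusion-)minimal system of `A`-homogeneous
generators of `I_A` contains one and only one polynomial of degree `α`. -/
def IsIndispensableDegree (k : Type*) [Field k] {A : Type*} [AddCommMonoid A] {r : ℕ}
    (a : Fin r → A) (α : A) : Prop :=
  ∀ S : Set (MvPolynomial (Fin r) k), Minimal (IsHomogeneousGenSystem a) S →
    ∃! f : MvPolynomial (Fin r) k, f ∈ S ∧ IsWeightedHomogeneous a f α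

/-- `f` is an indispensable binomial of `I_A`: a binomial which is the polynomial of degree `α` in
a minimal system of `A`-homogeneous generators of `I_A`, for an indispensable degree `α`. -/
def IsIndispensableBinomial {k : Type*} [Field k] {A : Type*} [AddCommMonoid A] {r : ℕ}
    (a : Fin r → A) (f : MvPolynomial (Fin r) k) : Prop :=
  IsBinomial f ∧ ∃ α : A, IsIndispensableDegree k a α ∧ IsWeightedHomogeneous a f α ∧
    ∃ S : Set (MvPolynomial (Fin r) k), Minimal (IsHomogeneousGenSystem a) S ∧ f ∈ S

/-- The term order `m` is represented by the matrix `M`: exponents are compared by comparing their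
images under `M` lexicographically. -/
def IsRepresentedBy {r : ℕ} (m : MonomialOrder (Fin r)) (M : Matrix (Fin r) (Fin r) ℝ) : Prop :=
  ∀ u v : Fin r →₀ ℕ, m.toSyn u ≤ m.toSyn v ↔
    toLex (M.mulVec fun j => (u j : ℝ)) ≤ toLex (M.mulVec fun j => (v j : ℝ))

/-- `m` is a degree reverse lexicographical term order, relative to the grading `deg X_j = d j`,
which has `X_i` as lowest variable: it is represented by an `r × r` matrix with first row `d` and
(when there is one) second row `-e_i`. -/
def IsDegRevLexWithLowest {r : ℕ} (d : Fin r → ℕ) (i : Fin r) (m : MonomialOrder (Fin r)) : Prop :=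
  ∃ M : Matrix (Fin r) (Fin r) ℝ, IsRepresentedBy m M ∧
    (∀ h : 0 < r, M ⟨0, h⟩ = fun j => (d j : ℝ)) ∧
    (∀ h : 1 < r, M ⟨1, h⟩ = -Pi.single i 1)

/-- `G` is a Gröbner basis of `I`: it is contained in `I` and the initial monomial of every nonzero
element of `I` is divisible by the initial monomial of a nonzero element of `G`. -/
def IsGroebnerBasis {k : Type*} [Field k] {r : ℕ} (m : MonomialOrder (Fin r))
    (I : Ideal (MvPolynomial (Fin r) k)) (G : Set (MvPolynomial (Fin r) k)) : Prop :=
  G ⊆ I ∧ ∀ f ∈ I, f ≠ 0 → ∃ g ∈ G, g ≠ 0 ∧ m.degree g ≤ m.degree f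

/-- `G` is the reduced Gröbner basis of `I`: a Gröbner basis consisting of monic polynomials, such
that no monomial of an element of `G` is divisible by the initial monomial of another element. -/
def IsReducedGroebnerBasis {k : Type*} [Field k] {r : ℕ} (m : MonomialOrder (Fin r))
    (I : Ideal (MvPolynomial (Fin r) k)) (G : Set (MvPolynomial (Fin r) k)) : Prop :=
  IsGroebnerBasis m I G ∧ (∀ g ∈ G, m.Monic g) ∧
    ∀ g ∈ G, ∀ g' ∈ G, g' ≠ g → ∀ u ∈ g.support, ¬ m.degree g' ≤ u

/-- The elements of `G`, each divided by its leading coefficient with respect to `m`. -/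
def makeMonic {k : Type*} [Field k] {r : ℕ} (m : MonomialOrder (Fin r))
    (G : Set (MvPolynomial (Fin r) k)) : Set (MvPolynomial (Fin r) k) :=
  (fun g => C (m.leadingCoeff g)⁻¹ * g) '' G

/-- `G` is, up to nonzero scalar multiples of its elements (for binomials: up to sign), the reduced
Gröbner basis of `I` with respect to `m`. A set of binomials which is a reduced Gröbner basis with
respect to several orders can only be so up to sign, since the sign that makes `X^u - X^v` monic
depends on which of the two monomials is the larger one. -/
def IsReducedGroebnerBasisUpToScalars {k : Type*} [Field k] {r : ℕ} (m : MonomialOrder (Fin r))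
    (I : Ideal (MvPolynomial (Fin r) k)) (G : Set (MvPolynomial (Fin r) k)) : Prop :=
  IsReducedGroebnerBasis m I (makeMonic m G)

end SemigroupIdeal

end

open MvPolynomial SemigroupIdeal

namespace SemigroupIdeal

variable {k : Type*} [Field k] {A : Type*} [AddCommMonoid A] {r : ℕ} {a : Fin r → A}

/-! ### Membership in the semigroup ideal -/

/-! Call the monomials of a given `A`-degree a fiber. Each element of `G` turns out to be, up to a
scalar, `X^u - X^v` with `X^u`, `X^v` coprime and `{u, v}` a whole fiber; any homogeneous generating
system must then contain a multiple of it (`IsIsolatedPair.exists_smul_mem`), so it is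
indispensable.

For the `i`-th order, the minimum of a fiber has the largest exponent of `X_i`. As `u` or `v` is
this minimum for every `i`, any `w` in the fiber is bounded by `max u v`. If `w` misses the
variables of `v`, then `w ≤ u`, so `w = u` because the `d_i` are positive; symmetrically for `v`. If
`w` shares `X_i` with `v` and `X_j` with `u`, then `X^v` leads for the `j`-th order, and dividing
`X^v` and `X^w` by `X_i` exhibits a proper divisor of `X^v` in the initial ideal, against
reducedness (`isIsolatedPair_of_forall_isReducedPair`). -/

theorem aeval_single_monomial (a : Fin r → A) (u : Fin r →₀ ℕ) (c : k) :
    aeval (fun i => AddMonoidAlgebra.single (a i) (1 : k)) (monomial u c) =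
      AddMonoidAlgebra.single (Finsupp.weight a u) c := by
  induction u using Finsupp.induction_linear generalizing c with
  | zero =>
    rw [← C_apply, algHom_C, map_zero]
    rfl
  | add u v hu hv =>
    rw [show monomial (u + v) c = monomial u c * monomial v (1 : k) by simp [monomial_mul],
      map_mul, hu, hv, AddMonoidAlgebra.single_mul_single, map_add, mul_one]
  | single i n =>
    rw [show monomial (Finsupp.single i n) c = C c * X i ^ n by
      rw [X_pow_eq_monomial, C_mul_monomial, mul_one]]
    rw [map_mul, map_pow, aeval_X, algHom_C, AddMonoidAlgebra.single_pow, Finsupp.weight_single]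
    change AddMonoidAlgebra.single 0 c * _ = _
    rw [AddMonoidAlgebra.single_mul_single]
    simp

theorem binomial_mem {u v : Fin r →₀ ℕ} (h : Finsupp.weight a u = Finsupp.weight a v) :
    (monomial u 1 - monomial v 1 : MvPolynomial (Fin r) k) ∈ semigroupIdeal k a := by
  rw [semigroupIdeal, RingHom.mem_ker, map_sub, aeval_single_monomial, aeval_single_monomial, h,
    sub_self]

theorem sum_coeff_fiber_eq_zero [DecidableEq A] {f : MvPolynomial (Fin r) k}
    (hf : f ∈ semigroupIdeal k a) (α : A) :
    ∑ u ∈ f.support with Finsupp.weight a u = α, coeff u f = 0 := by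
  rw [semigroupIdeal, RingHom.mem_ker, f.as_sum, map_sum] at hf
  simp only [aeval_single_monomial] at hf
  have h := congrArg (fun x => AddMonoidAlgebra.coeff x α) hf
  simp only [AddMonoidAlgebra.coeff_sum, AddMonoidAlgebra.coeff_single, Finsupp.finsetSum_apply,
    Finsupp.single_apply] at h
  rw [Finset.sum_filter]
  simpa using h

theorem exists_ne_mem_support {f : MvPolynomial (Fin r) k} (hf : f ∈ semigroupIdeal k a)
    {u : Fin r →₀ ℕ} (hu : u ∈ f.support) :
    ∃ v ∈ f.support, v ≠ u ∧ Finsupp.weight a v = Finsupp.weight a u := by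
  classical
  by_contra! H
  have h := sum_coeff_fiber_eq_zero hf (Finsupp.weight a u)
  rw [Finset.sum_eq_single_of_mem u (by simpa using hu)] at h
  · exact mem_support_iff.1 hu h
  · intro v hv hne
    rw [Finset.mem_filter] at hv
    exact absurd hv.2 (H v hv.1 hne)

/-- If the fiber of `u` is `{u, v}`, then the homogeneous elements of the semigroup ideal whose
degree is that of `u` are the scalar multiples of `X ^ u - X ^ v`. -/
theorem eq_smul_binomial {u v : Fin r →₀ ℕ} (huv : u ≠ v)
    (hw : Finsupp.weight a u = Finsupp.weight a v)
    (hfib : ∀ w, Finsupp.weight a w = Finsupp.weight a u → w = u ∨ w = v)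
    {f : MvPolynomial (Fin r) k} (hf : f ∈ semigroupIdeal k a)
    (hfh : IsWeightedHomogeneous a f (Finsupp.weight a u)) :
    f = coeff u f • (monomial u 1 - monomial v 1) := by
  have hmem : f - coeff u f • (monomial u 1 - monomial v 1) ∈ semigroupIdeal k a := by
    rw [smul_eq_C_mul]
    exact sub_mem hf (Ideal.mul_mem_left _ _ (binomial_mem hw))
  rw [← sub_eq_zero]
  -- Only `X^v` can survive in the difference, and an element of the ideal cannot have a monomial
  -- alone in its fiber.
  have hz : ∀ w, w ≠ v → coeff w (f - coeff u f • (monomial u 1 - monomial v 1)) = 0 := by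
    intro w hwv
    by_cases hwu : w = u
    · subst hwu
      simp [coeff_monomial, Ne.symm hwv]
    · have : coeff w f = 0 := by
        by_contra h
        exact (hfib w (hfh h)).elim hwu hwv
      simp [coeff_monomial, Ne.symm hwv, Ne.symm hwu, this]
  ext w
  rw [coeff_zero]
  by_contra hne
  have hwv : w = v := by
    by_contra h
    exact hne (hz w h)
  obtain ⟨w', hw', hne', -⟩ := exists_ne_mem_support hmem (mem_support_iff.2 hne)
  exact mem_support_iff.1 hw' (hz w' (hwv ▸ hne'))

/-- Every monomial of a polynomial in the ideal generated by `S` is divisible by a monomial of an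
element of `S`. -/
theorem exists_le_of_mem_span {S : Set (MvPolynomial (Fin r) k)} {f : MvPolynomial (Fin r) k}
    (hf : f ∈ Ideal.span S) {u : Fin r →₀ ℕ} (hu : coeff u f ≠ 0) :
    ∃ s ∈ S, ∃ q ∈ s.support, q ≤ u := by
  classical
  induction hf using Submodule.span_induction generalizing u with
  | mem x hx => exact ⟨x, hx, u, mem_support_iff.2 hu, le_rfl⟩
  | zero => simp at hu
  | add x y _ _ hx hy =>
    by_cases h : coeff u x = 0
    · exact hy (by simpa [h] using hu)
    · exact hx h
  | smul c x _ hx =>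
    rw [smul_eq_mul, coeff_mul] at hu
    obtain ⟨p, hp, hne⟩ := Finset.exists_ne_zero_of_sum_ne_zero hu
    obtain ⟨s, hs, q, hq, hle⟩ := hx (right_ne_zero_of_mul hne)
    rw [Finset.HasAntidiagonal.mem_antidiagonal] at hp
    exact ⟨s, hs, q, hq, hle.trans (hp ▸ le_add_self)⟩

/-! ### Fibers with two coprime elements -/

/-- The fiber of `u` is `{u, v}`, and the two distinct monomials `X ^ u` and `X ^ v` are
coprime. -/
structure IsIsolatedPair (a : Fin r → A) (u v : Fin r →₀ ℕ) : Prop where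
  ne : u ≠ v
  weight_eq : Finsupp.weight a u = Finsupp.weight a v
  fiber : ∀ w, Finsupp.weight a w = Finsupp.weight a u → w = u ∨ w = v
  coprime : ∀ i, u i = 0 ∨ v i = 0

theorem IsIsolatedPair.isWeightedHomogeneous {u v : Fin r →₀ ℕ} (h : IsIsolatedPair a u v) :
    IsWeightedHomogeneous a (monomial u 1 - monomial v 1 : MvPolynomial (Fin r) k)
      (Finsupp.weight a u) := by
  classical
  intro w hw
  rw [coeff_sub, coeff_monomial, coeff_monomial] at hw
  split_ifs at hw with h1 h2 h2
  · rw [h1]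
  · rw [h1]
  · rw [← h2, h.weight_eq]
  · simp at hw

/-- Some monomial `X^q` of a generator divides `X^u`, say `u = q + p`. A second monomial `X^q'` of
the same degree gives `q' + p = v`, and coprimality forces `p = 0`. -/
theorem IsIsolatedPair.exists_smul_mem {u v : Fin r →₀ ℕ} (h : IsIsolatedPair a u v)
    {S : Set (MvPolynomial (Fin r) k)} (hS : IsHomogeneousGenSystem a S) :
    ∃ c : k, c ≠ 0 ∧ c • (monomial u 1 - monomial v 1) ∈ S := by
  have hsub : S ⊆ semigroupIdeal k a := hS.2 ▸ Ideal.subset_span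
  have hmem : (monomial u 1 - monomial v 1 : MvPolynomial (Fin r) k) ∈ Ideal.span S :=
    hS.2 ▸ binomial_mem h.weight_eq
  obtain ⟨s, hs, q, hq, hqu⟩ :=
    exists_le_of_mem_span hmem (u := u) (by simp [coeff_monomial, h.ne.symm])
  obtain ⟨q', -, hne, hw⟩ := exists_ne_mem_support (hsub hs) hq
  obtain ⟨p, rfl⟩ := exists_add_of_le hqu
  have hv : q' + p = v := by
    refine (h.fiber (q' + p) (by simp [hw])).resolve_left fun h' => hne (add_right_cancel h')
  have hp : p = 0 := by
    ext i
    have := h.coprime i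
    rw [← hv] at this
    simp only [Finsupp.coe_add, Pi.add_apply] at this
    simp only [Finsupp.coe_zero, Pi.zero_apply]
    omega
  subst hp
  rw [add_zero] at *
  obtain ⟨α, hα⟩ := hS.1 s hs
  have hα' := hα (mem_support_iff.1 hq)
  subst hα'
  refine ⟨coeff q s, mem_support_iff.1 hq, ?_⟩
  rwa [← eq_smul_binomial h.ne h.weight_eq h.fiber (hsub hs) hα]

theorem IsIsolatedPair.isIndispensableDegree {u v : Fin r →₀ ℕ} (h : IsIsolatedPair a u v) :
    IsIndispensableDegree k a (Finsupp.weight a u) := by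
  intro S hS
  obtain ⟨c, hc, hcS⟩ := h.exists_smul_mem hS.prop
  have hsub : S ⊆ semigroupIdeal k a := hS.prop.2 ▸ Ideal.subset_span
  refine ⟨_, ⟨hcS, ?_⟩, ?_⟩
  · intro w hw
    rw [coeff_smul] at hw
    exact h.isWeightedHomogeneous (right_ne_zero_of_mul hw)
  · rintro f ⟨hf, hfh⟩
    by_contra hne
    have hspan : Ideal.span (S \ {f}) = semigroupIdeal k a := by
      rw [← hS.prop.2]
      refine le_antisymm (Ideal.span_mono Set.sdiff_subset) (Ideal.span_le.2 fun s hs => ?_)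
      by_cases hsf : s = f
      · have hmem : c • (monomial u 1 - monomial v 1) ∈ Ideal.span (S \ {f}) :=
          Ideal.subset_span ⟨hcS, fun h => hne h.symm⟩
        have heq : f = C (coeff u f * c⁻¹) * c • (monomial u 1 - monomial v 1) := by
          rw [C_mul', smul_smul, inv_mul_cancel_right₀ hc]
          exact eq_smul_binomial h.ne h.weight_eq h.fiber (hsub hf) hfh
        have := Ideal.mul_mem_left _ (C (coeff u f * c⁻¹)) hmem
        rw [← heq] at this
        rwa [hsf]
      · exact Ideal.subset_span ⟨hs, hsf⟩
    exact (hS.le_of_le ⟨fun s hs => hS.prop.1 s hs.1, hspan⟩ Set.sdiff_subset hf).2 rfl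

/-! ### Reduced Gröbner bases of semigroup ideals -/

/-- The monomial `X ^ v` is the smallest one in its fiber. -/
def IsFiberMin (m : MonomialOrder (Fin r)) (a : Fin r → A) (v : Fin r →₀ ℕ) : Prop :=
  ∀ w, Finsupp.weight a w = Finsupp.weight a v → m.toSyn v ≤ m.toSyn w

/-- The monomial `X ^ u` is a minimal generator of the initial ideal of the semigroup ideal, and
`X ^ v` is its normal form. -/
structure IsReducedPair (m : MonomialOrder (Fin r)) (a : Fin r → A) (u v : Fin r →₀ ℕ) :
    Prop where
  ne : u ≠ v
  weight_eq : Finsupp.weight a u = Finsupp.weight a v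
  isFiberMin : IsFiberMin m a v
  isFiberMin_of_lt : ∀ w, w ≤ u → w ≠ u → IsFiberMin m a w

theorem not_isFiberMin_degree {m : MonomialOrder (Fin r)} {f : MvPolynomial (Fin r) k}
    (hf : f ∈ semigroupIdeal k a) (hf0 : f ≠ 0) : ¬ IsFiberMin m a (m.degree f) := by
  intro h
  obtain ⟨v, hv, hne, hw⟩ := exists_ne_mem_support hf (m.degree_mem_support hf0)
  exact hne (m.toSyn.injective (le_antisymm (m.le_degree hv) (h v hw)))

theorem degree_binomial {m : MonomialOrder (Fin r)} {u v : Fin r →₀ ℕ}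
    (h : m.toSyn v < m.toSyn u) :
    m.degree (monomial u 1 - monomial v 1 : MvPolynomial (Fin r) k) = u := by
  classical
  have hne : v ≠ u := fun h' => h.ne (congrArg _ h')
  rw [sub_eq_add_neg, MonomialOrder.degree_add_of_lt]
  · simp [MonomialOrder.degree_monomial]
  · rw [← map_neg]
    simpa [MonomialOrder.degree_monomial] using h

theorem exists_isFiberMin (m : MonomialOrder (Fin r)) (a : Fin r → A) (u : Fin r →₀ ℕ) :
    ∃ v, Finsupp.weight a v = Finsupp.weight a u ∧ IsFiberMin m a v := by
  have hwf : WellFounded fun v w : Fin r →₀ ℕ => m.toSyn v < m.toSyn w :=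
    InvImage.wf m.toSyn wellFounded_lt
  obtain ⟨v, hv, hmin⟩ := hwf.has_min {v | Finsupp.weight a v = Finsupp.weight a u} ⟨u, rfl⟩
  exact ⟨v, hv, fun w hw => not_lt.1 (hmin w (hw.trans hv))⟩

theorem IsFiberMin.of_le [IsCancelAdd A] {m : MonomialOrder (Fin r)} {v w : Fin r →₀ ℕ}
    (h : IsFiberMin m a v) (hwv : w ≤ v) : IsFiberMin m a w := by
  obtain ⟨p, rfl⟩ := exists_add_of_le hwv
  intro w' hw'
  have := h (w' + p) (by simp [hw'])
  simpa using this

/-- `X^v` is the fiber minimum below the leading monomial. Were `g` not the binomial, the difference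
would have as leading monomial a non-leading monomial of `g` lying in the initial ideal, which
reducedness forbids. -/
theorem IsReducedGroebnerBasis.exists_isReducedPair [IsCancelAdd A] {m : MonomialOrder (Fin r)}
    {G : Set (MvPolynomial (Fin r) k)}
    (hG : IsReducedGroebnerBasis m (semigroupIdeal k a) G) {g : MvPolynomial (Fin r) k}
    (hg : g ∈ G) : ∃ u v, IsReducedPair m a u v ∧ g = monomial u 1 - monomial v 1 := by
  classical
  obtain ⟨⟨hsub, hGB⟩, hmonic, hred⟩ := hG
  have hg0 : g ≠ 0 := (hmonic g hg).ne_zero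
  obtain ⟨v, hv, hmin⟩ := exists_isFiberMin m a (m.degree g)
  have hne : m.degree g ≠ v := fun h => not_isFiberMin_degree (hsub hg) hg0 (h ▸ hmin)
  have hdeg : m.degree g ∈ g.support := m.degree_mem_support hg0
  refine ⟨m.degree g, v, ⟨hne, hv.symm, hmin, ?_⟩, ?_⟩
  · intro w hwu hwne w' hw'
    by_contra! hlt
    obtain ⟨g', hg', -, hle⟩ := hGB _ (binomial_mem hw'.symm) (fun h0 => by
      have := congrArg (coeff w) h0
      have hne' : w' ≠ w := fun h' => hlt.ne (congrArg _ h')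
      simp [coeff_monomial, hne'] at this)
    rw [degree_binomial hlt] at hle
    by_cases hgg : g' = g
    · subst hgg
      exact hwne (le_antisymm hwu hle)
    · exact hred g hg g' hg' hgg _ hdeg (hle.trans hwu)
  · rw [← sub_eq_zero]
    by_contra h0
    have hI := sub_mem (hsub hg) (binomial_mem (k := k) hv.symm)
    obtain ⟨g', hg', hg'0, hle⟩ := hGB _ hI h0
    have hnmin := not_isFiberMin_degree (m := m) hI h0
    have hw := mem_support_iff.1 (m.degree_mem_support h0)
    set w := m.degree (g - (monomial (m.degree g) 1 - monomial v 1)) with hwdef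
    have hwv : v ≠ w := by
      rintro h
      exact hnmin (h ▸ hmin)
    have hwu : m.degree g ≠ w := by
      intro h
      rw [← h] at hw
      simp [coeff_monomial, hne.symm, (hmonic g hg).coeff_degree] at hw
    have hwg : w ∈ g.support := by
      rw [mem_support_iff]
      simpa [coeff_monomial, hwv, hwu] using hw
    by_cases hgg : g' = g
    · subst hgg
      exact hwu (m.toSyn.injective (le_antisymm (m.toSyn_monotone hle) (m.le_degree hwg)))
    · exact hred g hg g' hg' hgg _ hwg hle

/-! ### Degree reverse lexicographical orders -/

theorem IsDegRevLexWithLowest.toSyn_lt {d : Fin r → ℕ} {i : Fin r} {m : MonomialOrder (Fin r)}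
    (hm : IsDegRevLexWithLowest d i m) (hd : ∀ i, 0 < d i) {v w : Fin r →₀ ℕ}
    (hvw : Finsupp.weight d v = Finsupp.weight d w) (hlt : v i < w i) :
    m.toSyn w < m.toSyn v := by
  obtain ⟨M, hM, h0, h1⟩ := hm
  -- With one variable there is no second row, but equal `d`-degrees already force equal exponents.
  have hr : 1 < r := by
    by_contra! hr
    obtain rfl : r = 1 := le_antisymm hr i.pos
    obtain rfl := Subsingleton.elim i 0
    simp only [Finsupp.weight_eq_sum, Finset.univ_unique, Finset.sum_singleton,
      smul_eq_mul] at hvw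
    exact hlt.ne (Nat.eq_of_mul_eq_mul_right (hd 0) hvw)
  have hr0 : 0 < r := zero_lt_one.trans hr
  rw [← not_le, hM, not_le]
  refine ⟨⟨1, hr⟩, fun j hj => ?_, ?_⟩
  · obtain rfl : j = ⟨0, hr0⟩ := by
      ext
      exact Nat.lt_one_iff.1 hj
    simp only [Finsupp.weight_eq_sum, smul_eq_mul] at hvw
    simp only [Pi.toLex_apply, Matrix.mulVec, dotProduct, h0]
    have := congrArg (Nat.cast : ℕ → ℝ) hvw
    push_cast at this
    simpa only [mul_comm] using this.symm
  · simp only [Pi.toLex_apply, Matrix.mulVec, h1, neg_dotProduct, single_one_dotProduct]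
    simpa using hlt

theorem isIsolatedPair_of_forall_isReducedPair [IsCancelAdd A] {d : Fin r → ℕ}
    (hd : ∀ i, 0 < d i)
    (hcompat : ∀ u v : Fin r →₀ ℕ, Finsupp.weight a u = Finsupp.weight a v →
      Finsupp.weight d u = Finsupp.weight d v)
    {m : Fin r → MonomialOrder (Fin r)} (hm : ∀ i, IsDegRevLexWithLowest d i (m i))
    {u v : Fin r →₀ ℕ} (hne : u ≠ v) (hw : Finsupp.weight a u = Finsupp.weight a v)
    (h : ∀ i, IsReducedPair (m i) a u v ∨ IsReducedPair (m i) a v u) :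
    IsIsolatedPair a u v := by
  -- A fiber has constant `d`-degree, so the row `-e_i` decides.
  have key : ∀ {i : Fin r} {w w' : Fin r →₀ ℕ}, Finsupp.weight a w = Finsupp.weight a w' →
      IsFiberMin (m i) a w → w' i ≤ w i := by
    intro i w w' hww hmin
    by_contra! hlt
    exact absurd ((hm i).toSyn_lt hd (hcompat _ _ hww) hlt) (not_lt.2 (hmin w' hww.symm))
  have eq_of_le : ∀ {w w' : Fin r →₀ ℕ}, Finsupp.weight a w = Finsupp.weight a w' →
      w ≤ w' → w = w' := by
    intro w w' hww hle
    obtain ⟨p, rfl⟩ := exists_add_of_le hle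
    have h0 := hcompat _ _ hww
    rw [map_add, left_eq_add] at h0
    have hp : p = 0 := by
      ext l
      have := Finsupp.le_weight d (hd l).ne' p
      rw [Finsupp.coe_zero, Pi.zero_apply]
      omega
    rw [hp, add_zero]
  -- In a reduced pair the two monomials are coprime.
  have coprime : ∀ {i : Fin r} {u v : Fin r →₀ ℕ}, IsReducedPair (m i) a u v →
      ∀ j, u j = 0 ∨ v j = 0 := by
    intro i u v huv j
    by_contra! hj
    have hu : Finsupp.single j 1 ≤ u := by simpa using Nat.one_le_iff_ne_zero.2 hj.1
    have hv : Finsupp.single j 1 ≤ v := by simpa using Nat.one_le_iff_ne_zero.2 hj.2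
    obtain ⟨u', rfl⟩ := exists_add_of_le hu
    obtain ⟨v', rfl⟩ := exists_add_of_le hv
    have hw' : Finsupp.weight a u' = Finsupp.weight a v' := by
      simpa using huv.weight_eq
    -- `u'` is minimal as a proper divisor of `u`, yet `v ≤ u` gives `v' ≤ u'` in the order.
    have h1 := huv.isFiberMin_of_lt u' le_add_self (by simp) v' hw'.symm
    have h2 := huv.isFiberMin _ huv.weight_eq
    simp only [map_add, add_le_add_iff_left] at h2
    exact huv.ne (congrArg _ ((m i).toSyn.injective (le_antisymm h1 h2)))
  have hcop : ∀ j, u j = 0 ∨ v j = 0 := fun j =>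
    (h j).elim (fun h' => coprime h' j) fun h' => (coprime h' j).symm
  have hredv : ∀ {j}, v j ≠ 0 → IsReducedPair (m j) a u v := by
    intro j hj
    refine (h j).resolve_right fun h' => hj ?_
    have := key hw h'.isFiberMin
    have := hcop j
    omega
  have hredu : ∀ {j}, u j ≠ 0 → IsReducedPair (m j) a v u := by
    intro j hj
    refine (h j).resolve_left fun h' => hj ?_
    have := key hw.symm h'.isFiberMin
    have := hcop j
    omega
  refine ⟨hne, hw, fun w hwu => ?_, hcop⟩
  have hwv := hwu.trans hw
  have hle : ∀ l, w l ≤ u l ∨ w l ≤ v l := fun l =>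
    (h l).elim (fun h' => .inr (key hwv.symm h'.isFiberMin))
      fun h' => .inl (key hwu.symm h'.isFiberMin)
  by_cases hi : ∃ i, w i ≠ 0 ∧ v i ≠ 0
  · by_cases hj : ∃ j, w j ≠ 0 ∧ u j ≠ 0
    · -- Cancelling `X_i` from `X ^ v - X ^ w` contradicts the minimality of `X ^ v` among the
      -- generators of the initial ideal for the `j`-th order.
      exfalso
      obtain ⟨i, hwi, hvi⟩ := hi
      obtain ⟨j, hwj, huj⟩ := hj
      have hv : Finsupp.single i 1 ≤ v := by simpa using Nat.one_le_iff_ne_zero.2 hvi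
      have hw1 : Finsupp.single i 1 ≤ w := by simpa using Nat.one_le_iff_ne_zero.2 hwi
      have hvj : v j = 0 := (hcop j).resolve_left huj
      have hred := hredu huj
      obtain ⟨v', rfl⟩ := exists_add_of_le hv
      obtain ⟨w', rfl⟩ := exists_add_of_le hw1
      have hw' : Finsupp.weight a w' = Finsupp.weight a v' := by simpa using hwv
      have h1 := hred.isFiberMin_of_lt v' le_add_self (by simp) w' hw'
      have h2 := (hm j).toSyn_lt hd (hcompat _ _ hwv.symm) (by omega)
      simp only [map_add, add_lt_add_iff_left] at h2
      exact absurd h1 (not_le.2 h2)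
    · push Not at hj
      refine .inr (eq_of_le hwv fun l => ?_)
      have := hle l
      have := hj l
      omega
  · push Not at hi
    refine .inl (eq_of_le hwu fun l => ?_)
    have := hle l
    have := hi l
    omega

/-! ### Indispensable binomials -/

theorem support_binomial {u v : Fin r →₀ ℕ} (h : u ≠ v) :
    (monomial u 1 - monomial v 1 : MvPolynomial (Fin r) k).support = {u, v} := by
  classical
  ext w
  rw [mem_support_iff, coeff_sub, coeff_monomial, coeff_monomial, Finset.mem_insert,
    Finset.mem_singleton]
  by_cases h1 : u = w
  · subst h1
    simp [h.symm]
  · by_cases h2 : v = w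
    · subst h2
      simp [h]
    · simp [h1, h2, Ne.symm h1, Ne.symm h2]

/-- A set of monic generators which are binomials of isolated pairs consists of indispensable
binomials. -/
theorem isIndispensableBinomial_of_forall_isIsolatedPair {m : MonomialOrder (Fin r)}
    {G : Set (MvPolynomial (Fin r) k)} (hspan : Ideal.span G = semigroupIdeal k a)
    (hmonic : ∀ g ∈ G, m.Monic g)
    (hG : ∀ g ∈ G, ∃ u v, IsIsolatedPair a u v ∧ g = monomial u 1 - monomial v 1)
    {g : MvPolynomial (Fin r) k} (hg : g ∈ G) : IsIndispensableBinomial a g := by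
  have hmin : Minimal (IsHomogeneousGenSystem a) G := by
    refine ⟨⟨fun f hf => ?_, hspan⟩, fun T hT hTG f hf => ?_⟩
    · obtain ⟨u, v, huv, rfl⟩ := hG f hf
      exact ⟨_, huv.isWeightedHomogeneous⟩
    · obtain ⟨u, v, huv, rfl⟩ := hG f hf
      obtain ⟨c, hc, hcT⟩ := huv.exists_smul_mem hT
      -- Both the binomial and its multiple by `c` lie in `G`, hence are monic, so `c = 1`.
      have h1 := hmonic _ (hTG hcT)
      have h2 := hmonic _ hf
      rw [MonomialOrder.Monic, smul_eq_C_mul, MonomialOrder.leadingCoeff_mul,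
        MonomialOrder.leadingCoeff_C, h2.leadingCoeff_eq_one, mul_one] at h1
      rwa [h1, one_smul] at hcT
  obtain ⟨u, v, huv, rfl⟩ := hG g hg
  exact ⟨⟨u, v, huv.ne, rfl⟩, _, huv.isIndispensableDegree, huv.isWeightedHomogeneous,
    G, hmin, hg⟩

theorem span_makeMonic (m : MonomialOrder (Fin r)) (G : Set (MvPolynomial (Fin r) k)) :
    Ideal.span (makeMonic m G) = Ideal.span G := by
  refine le_antisymm (Ideal.span_le.2 ?_) (Ideal.span_le.2 fun g hg => ?_)
  · rintro _ ⟨g, hg, rfl⟩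
    exact Ideal.mul_mem_left _ _ (Ideal.subset_span hg)
  · by_cases h0 : g = 0
    · rw [h0]
      exact zero_mem _
    · have hc : m.leadingCoeff g ≠ 0 := m.leadingCoeff_ne_zero_iff.2 h0
      have := Ideal.mul_mem_left (Ideal.span (makeMonic m G)) (C (m.leadingCoeff g))
        (Ideal.subset_span ⟨g, hg, rfl⟩)
      rwa [← mul_assoc, ← C_mul, mul_inv_cancel₀ hc, C_1, one_mul] at this

theorem support_makeMonic {m : MonomialOrder (Fin r)} {g : MvPolynomial (Fin r) k}
    (h : C (m.leadingCoeff g)⁻¹ * g ≠ 0) : (C (m.leadingCoeff g)⁻¹ * g).support = g.support := by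
  rw [C_mul', support_smul_eq]
  rintro h0
  simp [h0] at h

end SemigroupIdeal

theorem corollary3p3 {k : Type*} [Field k] {A : Type*} [AddCommMonoid A] [IsCancelAdd A]
    (hfin : SemigroupIdeal.IsCombinatoriallyFinite A)
    (htf : IsAddTorsionFree (Algebra.GrothendieckAddGroup A))
    {r : ℕ} (a : Fin r → A) (ha : AddSubmonoid.closure (Set.range a) = ⊤)
    (d : Fin r → ℕ) (hd : ∀ i, 0 < d i)
    (hcompat : ∀ u v : Fin r →₀ ℕ, Finsupp.weight a u = Finsupp.weight a v →
      Finsupp.weight d u = Finsupp.weight d v)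
    (m : Fin r → MonomialOrder (Fin r))
    (hm : ∀ i, SemigroupIdeal.IsDegRevLexWithLowest d i (m i))
    (G : Set (MvPolynomial (Fin r) k))
    (hG : Ideal.span G = SemigroupIdeal.semigroupIdeal k a)
    (hGB : ∀ i, SemigroupIdeal.IsReducedGroebnerBasisUpToScalars (m i)
      (SemigroupIdeal.semigroupIdeal k a) G) :
    Ideal.span {f : MvPolynomial (Fin r) k | SemigroupIdeal.IsIndispensableBinomial a f} =
      SemigroupIdeal.semigroupIdeal k a := by
  refine le_antisymm (Ideal.span_le.2 ?_) ?_
  · rintro f ⟨-, α, -, -, S, hS, hf⟩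
    exact hS.prop.2 ▸ Ideal.subset_span hf
  -- For `r = 0` no order is available, but the only monomial is `1` and the ideal is zero.
  · rcases Nat.eq_zero_or_pos r with rfl | hr
    · intro f hf
      have : f = 0 := by
        by_contra h0
        obtain ⟨u, hu⟩ := support_nonempty.2 h0
        obtain ⟨v, -, hne, -⟩ := exists_ne_mem_support hf hu
        exact hne (Subsingleton.elim _ _)
      rw [this]
      exact zero_mem _
    · let i₀ : Fin r := ⟨0, hr⟩
      have hspan := (span_makeMonic (m i₀) G).trans hG
      rw [← hspan]
      refine Ideal.span_mono fun f hf =>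
        isIndispensableBinomial_of_forall_isIsolatedPair hspan (hGB i₀).2.1 ?_ hf
      rintro _ ⟨g, hg, rfl⟩
      have hpair : ∀ i, ∃ u v, IsReducedPair (m i) a u v ∧
          C ((m i).leadingCoeff g)⁻¹ * g = monomial u 1 - monomial v 1 :=
        fun i => (hGB i).exists_isReducedPair ⟨g, hg, rfl⟩
      have hsupp : ∀ i u v, IsReducedPair (m i) a u v →
          C ((m i).leadingCoeff g)⁻¹ * g = monomial u 1 - monomial v 1 → g.support = {u, v} := by
        intro i u v h he
        rw [← support_binomial (k := k) h.ne, ← he, support_makeMonic]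
        exact ((hGB i).2.1 _ ⟨g, hg, rfl⟩).ne_zero
      obtain ⟨u, v, huv, he⟩ := hpair i₀
      refine ⟨u, v, isIsolatedPair_of_forall_isReducedPair hd hcompat hm huv.ne huv.weight_eq
        fun i => ?_, he⟩
      obtain ⟨u', v', huv', he'⟩ := hpair i
      -- Rescaling preserves the support of `g`, so changing the order can only swap `u` and `v`.
      have hs := (hsupp i₀ u v huv he).symm.trans (hsupp i u' v' huv' he')
      have hu : u' ∈ ({u, v} : Finset _) := hs ▸ Finset.mem_insert_self _ _
      have hv : v' ∈ ({u, v} : Finset _) := hs ▸ by simp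
      rw [Finset.mem_insert, Finset.mem_singleton] at hu hv
      have hne' := huv'.ne
      rcases hu with rfl | rfl <;> rcases hv with rfl | rfl
      · exact absurd rfl hne'
      · exact .inl huv'
      · exact .inr huv'
      · exact absurd rfl hne'
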